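/- Let $n,M,K\ge 1$, $w\in(0,1]$, let $\Sigma\in\mathbb{R}^{n\times n}$ be symmetric positive definite, let $y_1,\dots,y_M\in\mathbb{R}^n$, and let $B=\prod_{i=1}^n[a_i,b_i]$ be a box with $a_i<b_i$ and volume $V$. Let $$g(x)=(1-w)\frac1M\sum_{j=1}^M \mathcal N(x\mid y_j,\Sigma)+w\,\frac1V\,\mathbf 1_B(x)$$ be the data density $p(x\mid\mathcal E(\theta))$ (in the application, the $y_j$ are points of an ellipsoidal surface $\mathcal E(\theta)$). For $\sigma>0$ and $\xi=(\xi_1,\dots,\xi_K)\in(\mathbb{R}^n)^K$ let $$f(u,\xi)=\frac1K\sum_{i=1}^K\frac{1}{(2\pi\sigma^2)^{n/2}}\exp\Bigl(-\frac{\|u-\xi_i\|^2}{2\sigma^2}\Bigr)$$ be the Gaussian-mixture family without a uniform component, with parameter set $\Theta$, where $\Theta=(\mathbb{R}^n)^K$ or $\Theta\subseteq(\mathbb{R}^n)^K$ is compact. Let $I(g:f,\xi)=\mathbb{E}_{U\sim g}\log\bigl(g(U)/f(U,\xi)\bigr)$. Assume that $\mathbb{E}_{U\sim g}\,g(U)$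 exists and that $I(g:f,\cdot)$ has a unique minimizer $\xi_*$ over $\Theta$. Let $X_1,X_2,\dots$ be i.i.d. with density $g$, and let $\hat\xi_L$ be a quasi-maximum-likelihood estimator, that is, almost surely, for every $L\ge1$, $\hat\xi_L$ maximizes $\frac1L\sum_{i=1}^L\log f(X_i,\xi)$ over $\xi\in\Theta$. Then $\hat\xi_L\to\xi_*$ almost surely as $L\to\infty$. Moreover, $\log(g/f(\cdot,\xi))$ is integrable with respect to $g(x)\,dx$ for every $\xi\in(\mathbb{R}^n)^K$, so that $I(g:f,\xi)$ is finite; $I(g:f,\xi_*)>0$; and for no $\xi\in(\mathbb{R}^n)^K$ are $f(\cdot,\xi)$ and $g$ densities of the same distribution. -/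

import Mathlib

open MeasureTheory ProbabilityTheory Filter Topology

noncomputable section

/-- Density at `x` of the Gaussian distribution on `ℝⁿ` with mean `y` and covariance matrix `S`. -/
def gaussianDensity {n : ℕ} (S : Matrix (Fin n) (Fin n) ℝ)
    (y x : EuclideanSpace ℝ (Fin n)) : ℝ :=
  (Real.sqrt ((2 * Real.pi) ^ n * S.det))⁻¹ *
    Real.exp (-(1 / 2) * ((x - y).ofLp ⬝ᵥ (S⁻¹).mulVec (x - y).ofLp))

/-- The closed axis-parallel box with opposite corners `a` and `b`. -/
def axisBox {n : ℕ} (a b : EuclideanSpace ℝ (Fin n)) : Set (EuclideanSpace ℝ (Fin n)) :=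
  {x | ∀ i, x i ∈ Set.Icc (a i) (b i)}

/-- The volume of the box with opposite corners `a` and `b` (where `a i ≤ b i` for all `i`). -/
def axisBoxVolume {n : ℕ} (a b : EuclideanSpace ℝ (Fin n)) : ℝ :=
  ∏ i, (b i - a i)

/-- Density of the uniform distribution on the box with corners `a` and `b`:
the constant `1 / V` on the box, and `0` off it. -/
def boxUniformDensity {n : ℕ} (a b : EuclideanSpace ℝ (Fin n)) :
    EuclideanSpace ℝ (Fin n) → ℝ :=
  (axisBox a b).indicator fun _ => 1 / axisBoxVolume a b

/-- The data model: an equally weighted mixture of `M` Gaussians with means `y j` and covariance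
`S`, of total weight `1 - w`, plus the uniform distribution on a box, of weight `w`. -/
def dataDensity {n M : ℕ} (w : ℝ) (S : Matrix (Fin n) (Fin n) ℝ)
    (y : Fin M → EuclideanSpace ℝ (Fin n)) (a b : EuclideanSpace ℝ (Fin n))
    (x : EuclideanSpace ℝ (Fin n)) : ℝ :=
  (1 - w) * (1 / (M : ℝ)) * ∑ j, gaussianDensity S (y j) x + w * boxUniformDensity a b x

/-- The family without uniform component: the equally weighted mixture of `K` isotropic Gaussians
with variance `σ ^ 2`. Its parameter `ξ` is the vector of the `K` centers. -/
def mixtureDensity {n K : ℕ} (σ : ℝ) (u : EuclideanSpace ℝ (Fin n))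
    (ξ : Fin K → EuclideanSpace ℝ (Fin n)) : ℝ :=
  1 / (K : ℝ) * ∑ i, 1 / (2 * Real.pi * σ ^ 2) ^ ((n : ℝ) / 2) *
    Real.exp (-(1 / (2 * σ ^ 2)) * ‖u - ξ i‖ ^ 2)

/-- The measure on `ℝⁿ` with Lebesgue density `h` (for `h ≥ 0`). -/
def measureOfDensity {n : ℕ} (h : EuclideanSpace ℝ (Fin n) → ℝ) :
    Measure (EuclideanSpace ℝ (Fin n)) :=
  volume.withDensity fun x => ENNReal.ofReal (h x)

/-- The Kullback-Leibler information criterion `I(g : f, ξ) = E (log (g(U) / f(U, ξ)))`, where `U`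
has density `g`. -/
def klic {n K : ℕ} (g : EuclideanSpace ℝ (Fin n) → ℝ) (σ : ℝ)
    (ξ : Fin K → EuclideanSpace ℝ (Fin n)) : ℝ :=
  ∫ u, Real.log (g u / mixtureDensity σ u ξ) ∂(measureOfDensity g)

/-- The average quasi-log-likelihood of the first `L` observations `x 0, …, x (L - 1)`. -/
def quasiLogLikelihood {n K : ℕ} (σ : ℝ) (x : ℕ → EuclideanSpace ℝ (Fin n)) (L : ℕ)
    (ξ : Fin K → EuclideanSpace ℝ (Fin n)) : ℝ :=
  1 / (L : ℝ) * ∑ i ∈ Finset.range L, Real.log (mixtureDensity σ (x i) ξ)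

/-- `ξ` is a quasi-maximum-likelihood estimate over the parameter set `Θ` from the first `L`
observations. -/
def IsQMLE {n K : ℕ} (σ : ℝ) (Θ : Set (Fin K → EuclideanSpace ℝ (Fin n)))
    (x : ℕ → EuclideanSpace ℝ (Fin n)) (L : ℕ)
    (ξ : Fin K → EuclideanSpace ℝ (Fin n)) : Prop :=
  ξ ∈ Θ ∧ IsMaxOn (quasiLogLikelihood σ x L) Θ ξ

/-- `ξ` is the one and only minimizer of `I` over `Θ`. -/
def IsUniqueMinimizerOn {α : Type*} (I : α → ℝ) (Θ : Set α) (ξ : α) : Prop :=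
  ξ ∈ Θ ∧ IsMinOn I Θ ξ ∧ ∀ ξ' ∈ Θ, IsMinOn I Θ ξ' → ξ' = ξ

end

/-! The proof is Wald's consistency argument over a compactified parameter space. A function lying
between a positive multiple of a Gaussian and a constant has a logarithm of at most quadratic
growth, and the data have second moments; hence `log f` is integrable. So is `log g`, and the
information criterion is a constant minus the mean of `log f`. Its unique minimizer is therefore the
unique maximizer of the mean log-density.

On a compact set of parameters away from the maximizer, finitely many envelopes and the strong law
rule out every parameter at once (`ae_eventually_sum_lt_of_compact`). For unbounded `Θ`, each center
is compactified by a point at infinity, where its kernel vanishes. If some centers are infinite,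
moving them to the origin increases the density strictly everywhere, so such a vector stays strictly
below the maximum (`exists_mixture_envelope_infty`). A small Gaussian added to the limit keeps the
logarithms integrable even when all centers escape.

The remaining claims follow because `f` is continuous while `g` jumps across the boundary of the
box: the two cannot agree almost everywhere, and Gibbs' inequality is strict. -/

/-- A positive definite quadratic form is bounded below and above by multiples of the squared
norm. -/
theorem Matrix.PosDef.exists_quadraticForm_bounds {n : ℕ} {A : Matrix (Fin n) (Fin n) ℝ}
    (hA : A.PosDef) :
    ∃ l > 0, ∃ B > 0, ∀ x : EuclideanSpace ℝ (Fin n),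
      l * ‖x‖ ^ 2 ≤ x.ofLp ⬝ᵥ A.mulVec x.ofLp ∧ x.ofLp ⬝ᵥ A.mulVec x.ofLp ≤ B * ‖x‖ ^ 2 := by
  set Q : EuclideanSpace ℝ (Fin n) → ℝ := fun x => x.ofLp ⬝ᵥ A.mulVec x.ofLp with hQ
  have hcont : Continuous Q := by
    simp only [hQ, dotProduct, Matrix.mulVec]
    fun_prop
  have hpos : ∀ x, x ≠ 0 → 0 < Q x := by
    intro x hx
    have := hA.dotProduct_mulVec_pos (x := x.ofLp) (by simpa using hx)
    simpa [hQ] using this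
  have hsm : ∀ (c : ℝ) x, Q (c • x) = c ^ 2 * Q x := by
    intro c x
    simp only [hQ, WithLp.ofLp_smul, Matrix.mulVec_smul, dotProduct_smul, smul_dotProduct,
      smul_eq_mul]
    ring
  -- The unit sphere is empty when `n = 0`; there every vector is zero and any constants work.
  rcases (Metric.sphere (0 : EuclideanSpace ℝ (Fin n)) 1).eq_empty_or_nonempty with he | hne
  · refine ⟨1, one_pos, 1, one_pos, fun x => ?_⟩
    have hx : x = 0 := by
      by_contra hx
      have : (‖x‖⁻¹ • x) ∈ Metric.sphere (0 : EuclideanSpace ℝ (Fin n)) 1 := by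
        simp [norm_smul, hx]
      simp [he] at this
    simp [hx]
  · obtain ⟨x0, hx0, hmin⟩ := (isCompact_sphere (0 : EuclideanSpace ℝ (Fin n)) 1).exists_isMinOn
      hne hcont.continuousOn
    obtain ⟨x1, hx1, hmax⟩ := (isCompact_sphere (0 : EuclideanSpace ℝ (Fin n)) 1).exists_isMaxOn
      hne hcont.continuousOn
    refine ⟨Q x0, hpos _ (ne_zero_of_mem_unit_sphere ⟨x0, hx0⟩), Q x1,
      hpos _ (ne_zero_of_mem_unit_sphere ⟨x1, hx1⟩), fun x => ?_⟩
    rcases eq_or_ne x 0 with rfl | hx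
    · simp
    have hu : (‖x‖⁻¹ • x) ∈ Metric.sphere (0 : EuclideanSpace ℝ (Fin n)) 1 := by
      simp [norm_smul, hx]
    have hxe : Q x = ‖x‖ ^ 2 * Q (‖x‖⁻¹ • x) := by
      rw [hsm]
      have := norm_ne_zero_iff.2 hx
      field_simp
    have h1 : Q x0 ≤ Q (‖x‖⁻¹ • x) := hmin hu
    have h2 : Q (‖x‖⁻¹ • x) ≤ Q x1 := hmax hu
    change Q x0 * ‖x‖ ^ 2 ≤ Q x ∧ Q x ≤ Q x1 * ‖x‖ ^ 2
    rw [hxe]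
    constructor <;> nlinarith [sq_nonneg ‖x‖]

/-! ### Gaussian bounds and moments -/

section Gaussian

variable {n : ℕ}

theorem integrable_exp_neg_mul_sq_norm_sub {b : ℝ} (hb : 0 < b) (y : EuclideanSpace ℝ (Fin n)) :
    Integrable fun x : EuclideanSpace ℝ (Fin n) => Real.exp (-b * ‖x - y‖ ^ 2) := by
  have h := (GaussianFourier.integrable_cexp_neg_mul_sq_norm_add (b := (b : ℂ))
    (V := EuclideanSpace ℝ (Fin n)) (by simpa using hb) 0 0).norm
  have h' : Integrable fun x : EuclideanSpace ℝ (Fin n) => Real.exp (-b * ‖x‖ ^ 2) := by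
    refine h.congr (Eventually.of_forall fun x => ?_)
    simp [Complex.norm_exp, ← Complex.ofReal_pow]
  exact h'.comp_sub_right y

/-- A function dominated by a Gaussian has a second moment. -/
theorem integrable_mul_sq_norm_sub_of_le_gaussian {b C : ℝ} (hb : 0 < b)
    {h : EuclideanSpace ℝ (Fin n) → ℝ} (hm : Measurable h) (y x₀ : EuclideanSpace ℝ (Fin n))
    (hle : ∀ x, |h x| ≤ C * Real.exp (-b * ‖x - y‖ ^ 2)) :
    Integrable fun x => h x * ‖x - x₀‖ ^ 2 := by
  -- `D` is chosen so that the quadratic is at most `D * (1 + b / 2 * s)`, hence at most `D * exp (b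
  -- / 2 * s)`. Half of the Gaussian exponent absorbs the quadratic and the other half remains for
  -- integrability.
  set D := 2 * ‖y - x₀‖ ^ 2 + 4 / b with hD
  refine ((integrable_exp_neg_mul_sq_norm_sub (half_pos hb) y).const_mul (C * D)).mono'
    (by fun_prop) (Eventually.of_forall fun x => ?_)
  set s := ‖x - y‖ ^ 2
  have hs : 0 ≤ s := sq_nonneg _
  have hC : 0 ≤ C := by
    have := (abs_nonneg _).trans (hle x)
    exact nonneg_of_mul_nonneg_left this (Real.exp_pos _)
  have h1 : ‖x - x₀‖ ^ 2 ≤ 2 * s + 2 * ‖y - x₀‖ ^ 2 := by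
    have : ‖x - x₀‖ ≤ ‖x - y‖ + ‖y - x₀‖ := norm_sub_le_norm_sub_add_norm_sub _ _ _
    have h0 := norm_nonneg (x - x₀)
    calc ‖x - x₀‖ ^ 2 ≤ (‖x - y‖ + ‖y - x₀‖) ^ 2 := by gcongr
      _ ≤ _ := by nlinarith [sq_nonneg (‖x - y‖ - ‖y - x₀‖)]
  have h2 : 1 + b / 2 * s ≤ Real.exp (b / 2 * s) := by
    linarith [Real.add_one_le_exp (b / 2 * s)]
  have h3 : ‖x - x₀‖ ^ 2 ≤ D * Real.exp (b / 2 * s) := by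
    have hD0 : 0 ≤ D := by positivity
    have : 2 * s + 2 * ‖y - x₀‖ ^ 2 ≤ D * (1 + b / 2 * s) := by
      have : D * (1 + b / 2 * s) =
          2 * ‖y - x₀‖ ^ 2 + 4 / b + ‖y - x₀‖ ^ 2 * b * s + 2 * s := by
        rw [hD]; field_simp; ring
      rw [this]
      have : 0 ≤ ‖y - x₀‖ ^ 2 * b * s := by positivity
      have : 0 ≤ 4 / b := by positivity
      linarith
    exact h1.trans (this.trans (by gcongr))
  rw [Real.norm_eq_abs, abs_mul, abs_of_nonneg (sq_nonneg ‖x - x₀‖)]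
  calc |h x| * ‖x - x₀‖ ^ 2
      ≤ (C * Real.exp (-b * s)) * (D * Real.exp (b / 2 * s)) := by
        gcongr
        exact hle x
    _ = C * D * (Real.exp (-b * s) * Real.exp (b / 2 * s)) := by ring
    _ = C * D * Real.exp (-(b / 2) * s) := by
        rw [← Real.exp_add]; ring_nf

theorem continuous_gaussianDensity (S : Matrix (Fin n) (Fin n) ℝ)
    (y : EuclideanSpace ℝ (Fin n)) : Continuous (gaussianDensity S y) := by
  unfold gaussianDensity
  simp only [dotProduct, Matrix.mulVec]
  fun_prop

theorem gaussianDensity_nonneg (S : Matrix (Fin n) (Fin n) ℝ)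
    (y x : EuclideanSpace ℝ (Fin n)) : 0 ≤ gaussianDensity S y x := by
  unfold gaussianDensity
  positivity

theorem exists_gaussianDensity_bounds {S : Matrix (Fin n) (Fin n) ℝ} (hS : S.PosDef) :
    ∃ C > 0, ∃ l > 0, ∃ B > 0, ∀ y x : EuclideanSpace ℝ (Fin n),
      C * Real.exp (-B * ‖x - y‖ ^ 2) ≤ gaussianDensity S y x ∧
      gaussianDensity S y x ≤ C * Real.exp (-l * ‖x - y‖ ^ 2) := by
  obtain ⟨l, hl, B, hB, h⟩ := hS.inv.exists_quadraticForm_bounds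
  have hdet : 0 < S.det := hS.det_pos
  refine ⟨(Real.sqrt ((2 * Real.pi) ^ n * S.det))⁻¹, by positivity, l / 2, by positivity, B / 2,
    by positivity, fun y x => ?_⟩
  unfold gaussianDensity
  obtain ⟨h1, h2⟩ := h (x - y)
  exact ⟨mul_le_mul_of_nonneg_left (Real.exp_le_exp.2 (by linarith)) (by positivity),
    mul_le_mul_of_nonneg_left (Real.exp_le_exp.2 (by linarith)) (by positivity)⟩

end Gaussian

/-! ### The data density and its second moment -/

section DataDensity

variable {n M : ℕ}

theorem isCompact_axisBox (a b : EuclideanSpace ℝ (Fin n)) : IsCompact (axisBox a b) := by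
  have : axisBox a b =
      (EuclideanSpace.equiv (Fin n) ℝ).toHomeomorph ⁻¹' (Set.Icc a.ofLp b.ofLp) := by
    ext x
    simp [axisBox, Pi.le_def, forall_and]
  rw [this, Homeomorph.isCompact_preimage]
  exact isCompact_Icc

theorem axisBoxVolume_pos {a b : EuclideanSpace ℝ (Fin n)} (hab : ∀ i, a i < b i) :
    0 < axisBoxVolume a b :=
  Finset.prod_pos fun i _ => sub_pos.2 (hab i)

theorem measurable_boxUniformDensity (a b : EuclideanSpace ℝ (Fin n)) :
    Measurable (boxUniformDensity a b) :=
  measurable_const.indicator (isCompact_axisBox a b).measurableSet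

theorem boxUniformDensity_nonneg {a b : EuclideanSpace ℝ (Fin n)} (hab : ∀ i, a i < b i)
    (x : EuclideanSpace ℝ (Fin n)) : 0 ≤ boxUniformDensity a b x := by
  have := axisBoxVolume_pos hab
  exact Set.indicator_nonneg (fun _ _ => by positivity) x

theorem boxUniformDensity_le {a b : EuclideanSpace ℝ (Fin n)} (hab : ∀ i, a i < b i)
    (x : EuclideanSpace ℝ (Fin n)) : boxUniformDensity a b x ≤ 1 / axisBoxVolume a b := by
  have := axisBoxVolume_pos hab
  exact Set.indicator_le_self' (fun _ _ => by positivity) x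

theorem measurable_dataDensity (w : ℝ) (S : Matrix (Fin n) (Fin n) ℝ)
    (y : Fin M → EuclideanSpace ℝ (Fin n)) (a b : EuclideanSpace ℝ (Fin n)) :
    Measurable (dataDensity w S y a b) := by
  have h1 := fun j => (continuous_gaussianDensity S (y j)).measurable
  have h2 := measurable_boxUniformDensity a b
  unfold dataDensity
  fun_prop

theorem dataDensity_nonneg {w : ℝ} (hw0 : 0 < w) (hw1 : w ≤ 1) (S : Matrix (Fin n) (Fin n) ℝ)
    (y : Fin M → EuclideanSpace ℝ (Fin n)) {a b : EuclideanSpace ℝ (Fin n)}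
    (hab : ∀ i, a i < b i) (x : EuclideanSpace ℝ (Fin n)) : 0 ≤ dataDensity w S y a b x := by
  have h1 := boxUniformDensity_nonneg hab x
  have h2 : 0 ≤ ∑ j, gaussianDensity S (y j) x :=
    Finset.sum_nonneg fun j _ => gaussianDensity_nonneg S (y j) x
  have h3 : 0 ≤ 1 - w := sub_nonneg.2 hw1
  unfold dataDensity
  positivity

theorem exists_dataDensity_le {w : ℝ} (hw0 : 0 < w) (hw1 : w ≤ 1)
    {S : Matrix (Fin n) (Fin n) ℝ} (hS : S.PosDef)
    (y : Fin M → EuclideanSpace ℝ (Fin n)) {a b : EuclideanSpace ℝ (Fin n)}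
    (hab : ∀ i, a i < b i) : ∃ C, ∀ x, dataDensity w S y a b x ≤ C := by
  obtain ⟨C, hC, l, hl, B, hB, h⟩ := exists_gaussianDensity_bounds hS
  refine ⟨(1 - w) * (1 / (M : ℝ)) * ∑ _j : Fin M, C + w * (1 / axisBoxVolume a b), fun x => ?_⟩
  have h3 : 0 ≤ 1 - w := sub_nonneg.2 hw1
  unfold dataDensity
  gcongr with j
  · refine (h (y j) x).2.trans (mul_le_of_le_one_right hC.le (Real.exp_le_one_iff.2 ?_))
    have : 0 ≤ l * ‖x - y j‖ ^ 2 := by positivity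
    linarith
  · exact boxUniformDensity_le hab x

theorem integrable_dataDensity_mul_sq_norm (w : ℝ) {S : Matrix (Fin n) (Fin n) ℝ} (hS : S.PosDef)
    (y : Fin M → EuclideanSpace ℝ (Fin n)) (a b x₀ : EuclideanSpace ℝ (Fin n)) :
    Integrable fun x => dataDensity w S y a b x * ‖x - x₀‖ ^ 2 := by
  obtain ⟨C, hC, l, hl, B, hB, h⟩ := exists_gaussianDensity_bounds hS
  have h1 : ∀ j, Integrable fun x => gaussianDensity S (y j) x * ‖x - x₀‖ ^ 2 := fun j =>
    integrable_mul_sq_norm_sub_of_le_gaussian hl (continuous_gaussianDensity S (y j)).measurable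
      (y j) x₀ fun x => by
        rw [abs_of_nonneg (gaussianDensity_nonneg S (y j) x)]
        exact (h (y j) x).2
  have h2 : Integrable fun x => boxUniformDensity a b x * ‖x - x₀‖ ^ 2 := by
    have hc : Continuous fun x : EuclideanSpace ℝ (Fin n) =>
      1 / axisBoxVolume a b * ‖x - x₀‖ ^ 2 := by fun_prop
    have := (hc.continuousOn (s := axisBox a b)).integrableOn_compact (μ := volume)
      (isCompact_axisBox a b)
    rw [← integrable_indicator_iff (isCompact_axisBox a b).measurableSet] at this
    refine this.congr (Eventually.of_forall fun x => ?_)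
    by_cases hx : x ∈ axisBox a b <;> simp [boxUniformDensity, hx]
  have h3 := ((integrable_finsetSum Finset.univ fun j _ => h1 j).const_mul
    ((1 - w) * (1 / (M : ℝ)))).add (h2.const_mul w)
  refine h3.congr (Eventually.of_forall fun x => ?_)
  simp only [dataDensity, Pi.add_apply]
  rw [← Finset.sum_mul]
  ring

theorem integrable_measureOfDensity_iff {h : EuclideanSpace ℝ (Fin n) → ℝ} (hm : Measurable h)
    (h0 : ∀ x, 0 ≤ h x) {F : EuclideanSpace ℝ (Fin n) → ℝ} :
    Integrable F (measureOfDensity h) ↔ Integrable fun x => h x * F x := by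
  unfold measureOfDensity
  rw [integrable_withDensity_iff_integrable_smul' hm.ennreal_ofReal
    (Eventually.of_forall fun x => ENNReal.ofReal_lt_top)]
  simp [ENNReal.toReal_ofReal (h0 _)]

theorem ae_pos_measureOfDensity {h : EuclideanSpace ℝ (Fin n) → ℝ} (hm : Measurable h) :
    ∀ᵐ x ∂(measureOfDensity h), 0 < h x := by
  unfold measureOfDensity
  rw [ae_withDensity_iff hm.ennreal_ofReal]
  exact Eventually.of_forall fun x hx => by simpa using hx

end DataDensity

/-! ### Integrability of logarithms -/

section LogIntegrable

variable {n : ℕ}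

/-- The logarithm of the Gaussian lower bound is `log δ - β * s`. Negative values of `log v` are
thus at most linear in `s`, which will be a squared distance; this is why a second moment suffices
throughout. -/
theorem abs_log_le_of_gaussian_bounds {δ β C s v : ℝ} (hδ : 0 < δ) (hβ : 0 ≤ β) (hs : 0 ≤ s)
    (h1 : δ * Real.exp (-β * s) ≤ v) (h2 : v ≤ C) :
    |Real.log v| ≤ |Real.log C| + |Real.log δ| + β * s := by
  have h0 : 0 < δ * Real.exp (-β * s) := by positivity
  have hv : 0 < v := h0.trans_le h1
  have h3 := Real.log_le_log h0 h1
  rw [Real.log_mul hδ.ne' (Real.exp_pos _).ne', Real.log_exp] at h3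
  have h4 := Real.log_le_log hv h2
  have hbs : 0 ≤ β * s := by positivity
  rw [abs_le]
  constructor
  · linarith [neg_abs_le (Real.log δ), abs_nonneg (Real.log C)]
  · linarith [le_abs_self (Real.log C), abs_nonneg (Real.log δ)]

/-- The logarithm of a bounded function that dominates a Gaussian is integrable for any finite
measure with a second moment. -/
theorem integrable_log_of_gaussian_bounds {μ : Measure (EuclideanSpace ℝ (Fin n))}
    [IsFiniteMeasure μ] {x₀ : EuclideanSpace ℝ (Fin n)}
    (hμ : Integrable (fun x => ‖x - x₀‖ ^ 2) μ) {F : EuclideanSpace ℝ (Fin n) → ℝ}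
    (hF : Measurable F) {δ β C : ℝ} (hδ : 0 < δ) (hβ : 0 ≤ β)
    (h : ∀ᵐ x ∂μ, δ * Real.exp (-β * ‖x - x₀‖ ^ 2) ≤ F x ∧ F x ≤ C) :
    Integrable (fun x => Real.log (F x)) μ := by
  refine ((integrable_const (|Real.log C| + |Real.log δ|)).add (hμ.const_mul β)).mono'
    hF.log.aestronglyMeasurable (h.mono fun x hx => ?_)
  simpa using abs_log_le_of_gaussian_bounds hδ hβ (sq_nonneg _) hx.1 hx.2

/-- For `w < 1` a single Gaussian component bounds the density from below. For `w = 1` that bound is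
lost off the box, but there the density is zero and the data never fall. -/
theorem integrable_log_dataDensity {M : ℕ} (hM : 0 < M) {w : ℝ} (hw0 : 0 < w) (hw1 : w ≤ 1)
    {S : Matrix (Fin n) (Fin n) ℝ} (hS : S.PosDef) (y : Fin M → EuclideanSpace ℝ (Fin n))
    {a b : EuclideanSpace ℝ (Fin n)} (hab : ∀ i, a i < b i)
    [IsFiniteMeasure (measureOfDensity (dataDensity w S y a b))]
    (hμ : ∀ x₀, Integrable (fun x => ‖x - x₀‖ ^ 2) (measureOfDensity (dataDensity w S y a b))) :
    Integrable (fun x => Real.log (dataDensity w S y a b x))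
      (measureOfDensity (dataDensity w S y a b)) := by
  have hg := measurable_dataDensity w S y a b
  obtain ⟨C, hC⟩ := exists_dataDensity_le hw0 hw1 hS y hab
  have hV := axisBoxVolume_pos hab
  rcases hw1.lt_or_eq with hw | rfl
  · obtain ⟨A, hA, l, hl, B, hB, h⟩ := exists_gaussianDensity_bounds hS
    have hw' : 0 < 1 - w := sub_pos.2 hw
    have hM' : (0 : ℝ) < M := Nat.cast_pos.2 hM
    refine integrable_log_of_gaussian_bounds (hμ (y ⟨0, hM⟩)) hg
      (δ := (1 - w) * (1 / (M : ℝ)) * A) (β := B) (C := C) (by positivity) hB.le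
      (Eventually.of_forall fun x => ⟨?_, hC x⟩)
    have h1 : A * Real.exp (-B * ‖x - y ⟨0, hM⟩‖ ^ 2) ≤ ∑ j, gaussianDensity S (y j) x :=
      (h (y ⟨0, hM⟩) x).1.trans (Finset.single_le_sum
        (f := fun j => gaussianDensity S (y j) x)
        (fun j _ => gaussianDensity_nonneg S (y j) x) (Finset.mem_univ _))
    have h2 := boxUniformDensity_nonneg hab x
    unfold dataDensity
    have h3 : (1 - w) * (1 / (M : ℝ)) * (A * Real.exp (-B * ‖x - y ⟨0, hM⟩‖ ^ 2)) ≤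
      (1 - w) * (1 / (M : ℝ)) * ∑ j, gaussianDensity S (y j) x := by gcongr
    have h4 : 0 ≤ w * boxUniformDensity a b x := by positivity
    linarith
  -- With `w = 1` the logarithm is almost surely the constant `log (1 / V)`.
  · refine (integrable_const (Real.log (1 / axisBoxVolume a b))).congr ?_
    filter_upwards [ae_pos_measureOfDensity hg] with x hx
    by_cases hxb : x ∈ axisBox a b
    · simp [dataDensity, boxUniformDensity, hxb]
    · simp [dataDensity, boxUniformDensity, hxb] at hx

end LogIntegrable

/-! ### The Gaussian mixtures, and why they differ from the data density -/

section Mixture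

variable {n K : ℕ} {σ : ℝ}

/-- The common weight of the Gaussian kernels in `mixtureDensity`. -/
noncomputable def mixtureWeight (n K : ℕ) (σ : ℝ) : ℝ :=
  1 / (K : ℝ) * (1 / (2 * Real.pi * σ ^ 2) ^ ((n : ℝ) / 2))

theorem mixtureWeight_pos (hK : 0 < K) (hσ : 0 < σ) : 0 < mixtureWeight n K σ := by
  have : (0 : ℝ) < K := Nat.cast_pos.2 hK
  unfold mixtureWeight
  positivity

theorem mixtureDensity_eq (σ : ℝ) (u : EuclideanSpace ℝ (Fin n))
    (ξ : Fin K → EuclideanSpace ℝ (Fin n)) :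
    mixtureDensity σ u ξ =
      mixtureWeight n K σ * ∑ i, Real.exp (-(1 / (2 * σ ^ 2)) * ‖u - ξ i‖ ^ 2) := by
  simp only [mixtureDensity, mixtureWeight]
  rw [← Finset.mul_sum]
  ring

theorem continuous_mixtureDensity (σ : ℝ) (ξ : Fin K → EuclideanSpace ℝ (Fin n)) :
    Continuous fun u => mixtureDensity σ u ξ := by
  unfold mixtureDensity
  fun_prop

/-- All terms of the sum are positive, so any one kernel is a lower bound. It serves both for
positivity and as the Gaussian minorant that integrability of the logarithm requires. -/
theorem mixtureWeight_mul_exp_le_mixtureDensity (hK : 0 < K) (hσ : 0 < σ) (i : Fin K)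
    (u : EuclideanSpace ℝ (Fin n)) (ξ : Fin K → EuclideanSpace ℝ (Fin n)) :
    mixtureWeight n K σ * Real.exp (-(1 / (2 * σ ^ 2)) * ‖u - ξ i‖ ^ 2) ≤
      mixtureDensity σ u ξ := by
  have := mixtureWeight_pos (n := n) hK hσ
  rw [mixtureDensity_eq]
  gcongr
  exact Finset.single_le_sum (f := fun i => Real.exp (-(1 / (2 * σ ^ 2)) * ‖u - ξ i‖ ^ 2))
    (fun _ _ => (Real.exp_pos _).le) (Finset.mem_univ i)

theorem mixtureDensity_pos (hK : 0 < K) (hσ : 0 < σ)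
    (u : EuclideanSpace ℝ (Fin n)) (ξ : Fin K → EuclideanSpace ℝ (Fin n)) :
    0 < mixtureDensity σ u ξ := by
  have := mixtureWeight_pos (n := n) hK hσ
  exact lt_of_lt_of_le (by positivity)
    (mixtureWeight_mul_exp_le_mixtureDensity hK hσ ⟨0, hK⟩ u ξ)

theorem exp_neg_mul_sq_le_one (σ r : ℝ) : Real.exp (-(1 / (2 * σ ^ 2)) * r ^ 2) ≤ 1 := by
  rw [Real.exp_le_one_iff]
  have : 0 ≤ 1 / (2 * σ ^ 2) * r ^ 2 := by positivity
  linarith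

theorem mixtureDensity_le (hK : 0 < K) (hσ : 0 < σ)
    (u : EuclideanSpace ℝ (Fin n)) (ξ : Fin K → EuclideanSpace ℝ (Fin n)) :
    mixtureDensity σ u ξ ≤ mixtureWeight n K σ * K := by
  have := mixtureWeight_pos (n := n) hK hσ
  rw [mixtureDensity_eq]
  gcongr
  calc ∑ i, Real.exp (-(1 / (2 * σ ^ 2)) * ‖u - ξ i‖ ^ 2) ≤ ∑ _i : Fin K, (1 : ℝ) :=
        Finset.sum_le_sum fun i _ => exp_neg_mul_sq_le_one σ _
    _ = K := by simp

theorem integrable_mixtureDensity (hσ : 0 < σ) (ξ : Fin K → EuclideanSpace ℝ (Fin n)) :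
    Integrable fun u => mixtureDensity σ u ξ := by
  simp only [mixtureDensity_eq]
  exact (integrable_finsetSum _ fun i _ =>
    integrable_exp_neg_mul_sq_norm_sub (by positivity) (ξ i)).const_mul _

theorem integral_mixtureDensity (hK : 0 < K) (hσ : 0 < σ)
    (ξ : Fin K → EuclideanSpace ℝ (Fin n)) : ∫ u, mixtureDensity σ u ξ = 1 := by
  have hb : 0 < 1 / (2 * σ ^ 2) := by positivity
  have hK' : (K : ℝ) ≠ 0 := (Nat.cast_pos.2 hK).ne'
  simp only [mixtureDensity_eq]
  rw [integral_const_mul, integral_finsetSum _ fun i _ =>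
    integrable_exp_neg_mul_sq_norm_sub hb (ξ i)]
  have h1 : ∀ i, ∫ u, Real.exp (-(1 / (2 * σ ^ 2)) * ‖u - ξ i‖ ^ 2) =
      (2 * Real.pi * σ ^ 2) ^ ((n : ℝ) / 2) := by
    intro i
    rw [integral_sub_right_eq_self
      (fun u : EuclideanSpace ℝ (Fin n) => Real.exp (-(1 / (2 * σ ^ 2)) * ‖u‖ ^ 2)),
      GaussianFourier.integral_rexp_neg_mul_sq_norm hb]
    simp only [finrank_euclideanSpace, Fintype.card_fin]
    congr 1
    field_simp
  simp only [h1, Finset.sum_const, Finset.card_univ, Fintype.card_fin, nsmul_eq_mul,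
    mixtureWeight]
  have : (2 * Real.pi * σ ^ 2) ^ ((n : ℝ) / 2) ≠ 0 := by positivity
  field_simp

theorem isProbabilityMeasure_mixture (hK : 0 < K) (hσ : 0 < σ)
    (ξ : Fin K → EuclideanSpace ℝ (Fin n)) :
    IsProbabilityMeasure (measureOfDensity fun u => mixtureDensity σ u ξ) := by
  constructor
  rw [measureOfDensity, withDensity_apply _ MeasurableSet.univ, setLIntegral_univ,
    ← ofReal_integral_eq_lintegral_ofReal (integrable_mixtureDensity hσ ξ)
      (Eventually.of_forall fun u => (mixtureDensity_pos hK hσ u ξ).le),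
    integral_mixtureDensity hK hσ, ENNReal.ofReal_one]

theorem integrable_log_mixtureDensity (hK : 0 < K) (hσ : 0 < σ)
    {μ : Measure (EuclideanSpace ℝ (Fin n))} [IsFiniteMeasure μ]
    (hμ : ∀ x₀, Integrable (fun x => ‖x - x₀‖ ^ 2) μ) (ξ : Fin K → EuclideanSpace ℝ (Fin n)) :
    Integrable (fun u => Real.log (mixtureDensity σ u ξ)) μ :=
  integrable_log_of_gaussian_bounds (hμ (ξ ⟨0, hK⟩)) (continuous_mixtureDensity σ ξ).measurable
    (mixtureWeight_pos (n := n) hK hσ) (by positivity) (Eventually.of_forall fun u =>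
      ⟨mixtureWeight_mul_exp_le_mixtureDensity hK hσ ⟨0, hK⟩ u ξ, mixtureDensity_le hK hσ u ξ⟩)

/-- A function that is continuous up to a uniform component on a box is not almost everywhere
equal to a continuous function. -/
theorem not_ae_eq_add_boxUniformDensity (hn : 0 < n) {a b : EuclideanSpace ℝ (Fin n)}
    (hab : ∀ i, a i < b i) {w : ℝ} (hw : 0 < w) {F G : EuclideanSpace ℝ (Fin n) → ℝ}
    (hF : Continuous F) (hG : Continuous G) :
    ¬ F =ᵐ[volume] fun x => G x + w * boxUniformDensity a b x := by
  intro h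
  have hV := axisBoxVolume_pos hab
  set U : Set (EuclideanSpace ℝ (Fin n)) := {x | ∀ i, x i ∈ Set.Ioo (a i) (b i)} with hU
  have hUo : IsOpen U := by
    have : U = ⋂ i, (fun x : EuclideanSpace ℝ (Fin n) => x i) ⁻¹' Set.Ioo (a i) (b i) := by
      ext; simp [hU]
    rw [this]
    exact isOpen_iInter_of_finite fun i => isOpen_Ioo.preimage (by fun_prop)
  have h1 : Set.EqOn F (fun x => G x + w * (1 / axisBoxVolume a b)) U := by
    refine Measure.eqOn_open_of_ae_eq (μ := volume) ?_ hUo hF.continuousOn (by fun_prop)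
    filter_upwards [ae_restrict_of_ae h, ae_restrict_mem hUo.measurableSet] with x hx hxU
    have : x ∈ axisBox a b := fun i => Set.Ioo_subset_Icc_self (hxU i)
    simpa [boxUniformDensity, this] using hx
  have hBo : IsOpen (axisBox a b)ᶜ := (isCompact_axisBox a b).isClosed.isOpen_compl
  have h2 : Set.EqOn F G (axisBox a b)ᶜ := by
    refine Measure.eqOn_open_of_ae_eq (μ := volume) ?_ hBo hF.continuousOn hG.continuousOn
    filter_upwards [ae_restrict_of_ae h, ae_restrict_mem hBo.measurableSet] with x hx hxU
    rw [Set.mem_compl_iff] at hxU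
    simpa [boxUniformDensity, hxU] using hx
  -- The diagonal through the corner `b` is in the open box for small `t < 0` and off the closed box
  -- for `t > 0`. The two continuous expressions for `F` thus both hold at `b`, where they differ by
  -- the height of the jump. Leaving the box takes at least one coordinate, hence `0 < n`.
  have hline : Continuous fun t : ℝ => b + t • (b - a) := by fun_prop
  have h1b : F b = G b + w * (1 / axisBoxVolume a b) := by
    have hc := h1.closure hF (by fun_prop)
    refine hc (mem_closure_of_tendsto (f := fun t : ℝ => b + t • (b - a)) (b := 𝓝[<] 0) ?_ ?_)
    · have := (hline.tendsto 0).mono_left (nhdsWithin_le_nhds (s := Set.Iio 0))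
      simpa using this
    · filter_upwards [Ioo_mem_nhdsLT (show (-1 : ℝ) < 0 by norm_num)] with t ht i
      have := hab i
      simp only [PiLp.add_apply, PiLp.smul_apply, PiLp.sub_apply, smul_eq_mul, Set.mem_Ioo]
      constructor <;> nlinarith [ht.1, ht.2]
  have h2b : F b = G b := by
    refine h2.closure hF hG
      (mem_closure_of_tendsto (f := fun t : ℝ => b + t • (b - a)) (b := 𝓝[>] 0) ?_ ?_)
    · have := (hline.tendsto 0).mono_left (nhdsWithin_le_nhds (s := Set.Ioi 0))
      simpa using this
    · filter_upwards [self_mem_nhdsWithin] with t ht hmem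
      have := hab ⟨0, hn⟩
      have h3 := (hmem ⟨0, hn⟩).2
      simp only [PiLp.add_apply, PiLp.smul_apply, PiLp.sub_apply, smul_eq_mul] at h3
      nlinarith [Set.mem_Ioi.1 ht]
  have : 0 < w * (1 / axisBoxVolume a b) := by positivity
  linarith

/-- Equal measures have almost everywhere equal densities, whereas only the data density has a jump.
-/
theorem measureOfDensity_mixtureDensity_ne {M : ℕ} (hn : 0 < n) (hK : 0 < K) {w : ℝ}
    (hw0 : 0 < w) (hw1 : w ≤ 1) (S : Matrix (Fin n) (Fin n) ℝ)
    (y : Fin M → EuclideanSpace ℝ (Fin n)) {a b : EuclideanSpace ℝ (Fin n)}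
    (hab : ∀ i, a i < b i) (hσ : 0 < σ) (ξ : Fin K → EuclideanSpace ℝ (Fin n)) :
    measureOfDensity (fun u => mixtureDensity σ u ξ) ≠
      measureOfDensity (dataDensity w S y a b) := by
  intro h
  unfold measureOfDensity at h
  rw [withDensity_eq_iff_of_sigmaFinite
    (continuous_mixtureDensity σ ξ).measurable.ennreal_ofReal.aemeasurable
    (measurable_dataDensity w S y a b).ennreal_ofReal.aemeasurable] at h
  refine not_ae_eq_add_boxUniformDensity hn hab hw0 (continuous_mixtureDensity σ ξ)
    (G := fun x => (1 - w) * (1 / (M : ℝ)) * ∑ j, gaussianDensity S (y j) x) ?_ ?_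
  · have := fun j => continuous_gaussianDensity S (y j)
    fun_prop
  · filter_upwards [h] with x hx
    exact (ENNReal.ofReal_eq_ofReal_iff (mixtureDensity_pos hK hσ x ξ).le
      (dataDensity_nonneg hw0 hw1 S y hab x)).1 hx

end Mixture

/-! ### Positivity of the relative entropy -/

/-- Gibbs' inequality for two densities. -/
theorem integral_log_div_pos_of_measureOfDensity_ne {n : ℕ}
    {f g : EuclideanSpace ℝ (Fin n) → ℝ} (hf : Measurable f) (hg : Measurable g)
    (hf0 : ∀ x, 0 < f x) (hg0 : ∀ x, 0 ≤ g x) [IsProbabilityMeasure (measureOfDensity f)]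
    [IsProbabilityMeasure (measureOfDensity g)]
    (hint : Integrable (fun x => Real.log (g x / f x)) (measureOfDensity g))
    (hne : measureOfDensity f ≠ measureOfDensity g) :
    0 < ∫ x, Real.log (g x / f x) ∂(measureOfDensity g) := by
  -- Since `f` never vanishes, `g / f` is the Radon-Nikodym derivative, and the integral is a
  -- Kullback-Leibler divergence.
  have hgf : measureOfDensity g =
      (measureOfDensity f).withDensity fun x => ENNReal.ofReal (g x / f x) := by
    unfold measureOfDensity
    rw [← withDensity_mul (g := fun x => ENNReal.ofReal (g x / f x)) _ hf.ennreal_ofReal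
      (hg.div hf).ennreal_ofReal]
    congr 1
    ext x
    rw [Pi.mul_apply, ← ENNReal.ofReal_mul (hf0 x).le, mul_div_cancel₀ _ (hf0 x).ne']
  have hac : measureOfDensity g ≪ measureOfDensity f := by
    rw [hgf]
    exact withDensity_absolutelyContinuous _ _
  have hrn : (measureOfDensity g).rnDeriv (measureOfDensity f) =ᵐ[measureOfDensity f]
      fun x => ENNReal.ofReal (g x / f x) := by
    conv_lhs => rw [hgf]
    exact Measure.rnDeriv_withDensity _ (hg.div hf).ennreal_ofReal
  have hllr : llr (measureOfDensity g) (measureOfDensity f) =ᵐ[measureOfDensity g]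
      fun x => Real.log (g x / f x) := by
    filter_upwards [hac.ae_le hrn] with x hx
    simp only [llr_def, hx]
    rw [ENNReal.toReal_ofReal (div_nonneg (hg0 x) (hf0 x).le)]
  -- Both measures have mass one, so the divergence carries no mass correction. It is finite by
  -- `hint` and vanishes only for equal measures.
  rw [← integral_congr_ae hllr, ← InformationTheory.toReal_klDiv_of_measure_eq hac (by simp)]
  refine ENNReal.toReal_pos ?_ (InformationTheory.klDiv_ne_top hac (hint.congr hllr.symm))
  rw [Ne, InformationTheory.klDiv_eq_zero_iff]
  exact fun h => hne h.symm

/-! ### The strong law and Wald's compactness argument -/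

section Wald

/-- The strong law of large numbers for a function of i.i.d. observations. -/
theorem HasLaw.ae_tendsto_average {Ω E : Type*} [MeasurableSpace Ω] [MeasurableSpace E]
    {P : Measure Ω} {μ : Measure E} {X : ℕ → Ω → E} (hindep : iIndepFun X P)
    (hlaw : ∀ i, HasLaw (X i) μ P) {H : E → ℝ} (hH : Measurable H) (hint : Integrable H μ) :
    ∀ᵐ ω ∂P, Tendsto (fun L : ℕ => (∑ i ∈ Finset.range L, H (X i ω)) / L) atTop
      (𝓝 (∫ u, H u ∂μ)) := by
  have hmap := (hlaw 0).map_eq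
  have h := strong_law_ae_real (μ := P) (fun i ω => H (X i ω)) ?_ ?_ ?_
  · have he : ∫ ω, H (X 0 ω) ∂P = ∫ u, H u ∂μ := by
      rw [← hmap, integral_map (hlaw 0).aemeasurable hH.aestronglyMeasurable]
    rwa [he] at h
  · rw [← hmap] at hint
    exact hint.comp_aemeasurable (hlaw 0).aemeasurable
  · intro i j hij
    exact (hindep.indepFun hij).comp hH hH
  · intro i
    exact ((hlaw i).identDistrib (hlaw 0)).comp hH

/-- Wald's argument: if each parameter in a compact set has a neighbourhood on which the criterion
has an envelope with mean below that of the criterion at `t₀`, then almost surely no parameter in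
that set is eventually as good as `t₀`. -/
theorem ae_eventually_sum_lt_of_compact {Ω E T Z : Type*} [MeasurableSpace Ω] [MeasurableSpace E]
    [TopologicalSpace Z] {P : Measure Ω} {μ : Measure E} {X : ℕ → Ω → E}
    (hindep : iIndepFun X P) (hlaw : ∀ i, HasLaw (X i) μ P) {q : E → T → ℝ} {t₀ : T}
    (hqm : Measurable fun u => q u t₀) (hqi : Integrable (fun u => q u t₀) μ)
    (Θ : Set T) (ι : T → Z) {C : Set Z} (hC : IsCompact C)
    (henv : ∀ z ∈ C, ∃ V ∈ 𝓝 z, ∃ H : E → ℝ, Measurable H ∧ Integrable H μ ∧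
      (∀ t ∈ Θ, ι t ∈ V → ∀ u, q u t ≤ H u) ∧ ∫ u, H u ∂μ < ∫ u, q u t₀ ∂μ) :
    ∀ᵐ ω ∂P, ∀ᶠ L : ℕ in atTop, ∀ t ∈ Θ, ι t ∈ C →
      ∑ i ∈ Finset.range L, q (X i ω) t < ∑ i ∈ Finset.range L, q (X i ω) t₀ := by
  choose! V hV H hHm hHi hle hlt using henv
  -- A finite subcover leaves finitely many envelopes, so one null set and one threshold for `L`
  -- serve all parameters.
  obtain ⟨s, hsC, hs⟩ := hC.elim_nhds_subcover V hV
  have h1 : ∀ᵐ ω ∂P, ∀ z ∈ s, Tendsto (fun L : ℕ => (∑ i ∈ Finset.range L, H z (X i ω)) / L)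
      atTop (𝓝 (∫ u, H z u ∂μ)) := by
    refine (ae_ball_iff s.countable_toSet).2 fun z hz => HasLaw.ae_tendsto_average hindep hlaw (hHm z (hsC z hz)) (hHi z (hsC z hz))
  filter_upwards [h1, HasLaw.ae_tendsto_average hindep hlaw hqm hqi] with ω hω hω0
  have h2 : ∀ᶠ L : ℕ in atTop, ∀ z ∈ s,
      (∑ i ∈ Finset.range L, H z (X i ω)) / L < (∑ i ∈ Finset.range L, q (X i ω) t₀) / L := by
    rw [eventually_all_finset]
    exact fun z hz => (hω z hz).eventually_lt hω0 (hlt z (hsC z hz))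
  filter_upwards [h2, eventually_gt_atTop 0] with L hL hL0 t ht htC
  obtain ⟨z, hz, htz⟩ := Set.mem_iUnion₂.1 (hs htC)
  have h3 := (div_lt_div_iff_of_pos_right (Nat.cast_pos.2 hL0)).1 (hL z hz)
  exact (Finset.sum_le_sum fun i _ => hle z (hsC z hz) t ht htz (X i ω)).trans_lt h3

end Wald

/-! ### Gaussian kernels with a center at infinity -/

section Kernel

variable {E : Type*} [NormedAddCommGroup E]

/-- The continuous extension to the one-point compactification, in the center `z`, of the Gaussian
kernel: it vanishes for the center at infinity. -/
noncomputable def extendedKernel (σ : ℝ) (z : OnePoint E) (u : E) : ℝ :=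
  z.elim 0 fun x => Real.exp (-(1 / (2 * σ ^ 2)) * ‖u - x‖ ^ 2)

theorem extendedKernel_nonneg (σ : ℝ) (z : OnePoint E) (u : E) : 0 ≤ extendedKernel σ z u := by
  induction z with
  | infty => simp [extendedKernel]
  | coe x => simpa [extendedKernel] using (Real.exp_pos _).le

/-- Near each center, finite or infinite, the Gaussian kernels have continuous envelopes that
converge pointwise to the kernel of that center. -/
theorem exists_kernel_envelopes [ProperSpace E] (σ : ℝ) (hσ : 0 < σ) (z : OnePoint E) :
    ∃ (V : ℕ → Set (OnePoint E)) (h : ℕ → E → ℝ), (∀ k, V k ∈ 𝓝 z) ∧ (∀ k, Continuous (h k)) ∧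
      (∀ k u, 0 ≤ h k u) ∧ (∀ k u, h k u ≤ 1) ∧
      (∀ k (x : E) u, (x : OnePoint E) ∈ V k →
        Real.exp (-(1 / (2 * σ ^ 2)) * ‖u - x‖ ^ 2) ≤ h k u) ∧
      ∀ u, Tendsto (fun k => h k u) atTop (𝓝 (extendedKernel σ z u)) := by
  have hβ : 0 < 1 / (2 * σ ^ 2) := by positivity
  have key : ∀ r s : ℝ, max 0 r ≤ s →
      Real.exp (-(1 / (2 * σ ^ 2)) * s ^ 2) ≤
        Real.exp (-(1 / (2 * σ ^ 2)) * (max 0 r) ^ 2) := by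
    intro r s hrs
    rw [Real.exp_le_exp, neg_mul, neg_mul, neg_le_neg_iff]
    have : 0 ≤ max 0 r := le_max_left _ _
    gcongr
  induction z with
  | infty =>
    -- If `‖x‖ > k`, then `‖u - x‖` is at least `k - ‖u‖`. Truncation at `0` is needed because
    -- squaring is monotone only on nonnegative numbers.
    refine ⟨fun k => (OnePoint.some '' (Metric.closedBall (0 : E) k)ᶜ) ∪ {OnePoint.infty},
      fun k u => Real.exp (-(1 / (2 * σ ^ 2)) * (max 0 ((k : ℝ) - ‖u‖)) ^ 2),
      fun k => OnePoint.hasBasis_nhds_infty.mem_of_mem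
        ⟨Metric.isClosed_closedBall, isCompact_closedBall _ _⟩,
      fun k => by fun_prop, fun k u => (Real.exp_pos _).le, fun k u => exp_neg_mul_sq_le_one σ _,
      fun k x u hx => key _ _ (max_le (norm_nonneg _) ?_), fun u => ?_⟩
    · have hx' : (k : ℝ) < ‖x‖ := by simpa using hx
      have := norm_sub_norm_le x u
      rw [norm_sub_rev] at this
      linarith
    · have h1 : Tendsto (fun k : ℕ => (k : ℝ) - ‖u‖) atTop atTop :=
        tendsto_atTop_add_const_right _ _ tendsto_natCast_atTop_atTop
      have h2 : Tendsto (fun k : ℕ => max 0 ((k : ℝ) - ‖u‖)) atTop atTop :=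
        tendsto_atTop_mono (fun k => le_max_right _ _) h1
      have h3 : Tendsto (fun k : ℕ => (max 0 ((k : ℝ) - ‖u‖)) ^ 2) atTop atTop :=
        (tendsto_pow_atTop two_ne_zero).comp h2
      simpa [extendedKernel, Function.comp_def] using
        Real.tendsto_exp_atBot.comp (h3.const_mul_atTop_of_neg (neg_lt_zero.2 hβ))
  | coe y =>
    -- If `x` is within `1 / (k + 1)` of `y`, then `‖u - x‖` is at least `‖u - y‖ - 1 / (k + 1)`;
    -- the shift by one keeps the radius positive at `k = 0`.
    refine ⟨fun k => OnePoint.some '' Metric.ball y (1 / ((k : ℝ) + 1)),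
      fun k u => Real.exp (-(1 / (2 * σ ^ 2)) * (max 0 (‖u - y‖ - 1 / ((k : ℝ) + 1))) ^ 2),
      fun k => OnePoint.isOpenEmbedding_coe.isOpenMap.image_mem_nhds
        (Metric.ball_mem_nhds _ (by positivity)),
      fun k => by fun_prop, fun k u => (Real.exp_pos _).le, fun k u => exp_neg_mul_sq_le_one σ _,
      fun k x u hx => key _ _ (max_le (norm_nonneg _) ?_), fun u => ?_⟩
    · have hx' : ‖x - y‖ < 1 / ((k : ℝ) + 1) := by
        simpa [dist_eq_norm] using hx
      have := norm_sub_le_norm_sub_add_norm_sub u x y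
      linarith
    · have h1 : Tendsto (fun k : ℕ => ‖u - y‖ - 1 / ((k : ℝ) + 1)) atTop (𝓝 (‖u - y‖ - 0)) :=
        tendsto_const_nhds.sub tendsto_one_div_add_atTop_nhds_zero_nat
      have hc : Continuous fun r : ℝ => Real.exp (-(1 / (2 * σ ^ 2)) * (max 0 r) ^ 2) := by
        fun_prop
      have := (hc.tendsto _).comp h1
      simpa [extendedKernel, Function.comp_def] using this

end Kernel

/-! ### Envelopes for the log-density -/

section Envelope

variable {n K : ℕ} {σ : ℝ}

/-- Dominated convergence for the mean log-density along envelopes that dominate a fixed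
Gaussian. -/
theorem tendsto_integral_log_of_gaussian_bounds {μ : Measure (EuclideanSpace ℝ (Fin n))}
    [IsFiniteMeasure μ] {x₀ : EuclideanSpace ℝ (Fin n)}
    (hμ : Integrable (fun x => ‖x - x₀‖ ^ 2) μ) {F : ℕ → EuclideanSpace ℝ (Fin n) → ℝ}
    {F' : EuclideanSpace ℝ (Fin n) → ℝ} (hF : ∀ k, Measurable (F k)) {δ β C : ℝ} (hδ : 0 < δ)
    (hβ : 0 ≤ β) (hlow : ∀ k x, δ * Real.exp (-β * ‖x - x₀‖ ^ 2) ≤ F k x)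
    (hup : ∀ k x, F k x ≤ C) (hlim : ∀ x, Tendsto (fun k => F k x) atTop (𝓝 (F' x))) :
    Tendsto (fun k => ∫ x, Real.log (F k x) ∂μ) atTop (𝓝 (∫ x, Real.log (F' x) ∂μ)) := by
  refine tendsto_integral_of_dominated_convergence
    (fun x => |Real.log C| + |Real.log δ| + β * ‖x - x₀‖ ^ 2)
    (fun k => (hF k).log.aestronglyMeasurable)
    ((integrable_const (|Real.log C| + |Real.log δ|)).add (hμ.const_mul β))
    (fun k => Eventually.of_forall fun x => ?_) (Eventually.of_forall fun x => ?_)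
  · exact abs_log_le_of_gaussian_bounds hδ hβ (sq_nonneg _) (hlow k x) (hup k x)
  · have : δ * Real.exp (-β * ‖x - x₀‖ ^ 2) ≤ F' x :=
      ge_of_tendsto (hlim x) (Eventually.of_forall fun k => hlow k x)
    have h0 : 0 < δ * Real.exp (-β * ‖x - x₀‖ ^ 2) := by positivity
    exact (hlim x).log (h0.trans_le this).ne'

/-- The envelope condition of Wald's argument near a vector of centers in the one-point
compactification, given a function `ψ` such that adding `ψ` to the extended mixture makes it
dominate a Gaussian and have mean logarithm below `m`. -/
theorem exists_mixture_envelope (hK : 0 < K) (hσ : 0 < σ)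
    {μ : Measure (EuclideanSpace ℝ (Fin n))} [IsFiniteMeasure μ]
    (hμ : ∀ x₀, Integrable (fun x => ‖x - x₀‖ ^ 2) μ)
    (z : Fin K → OnePoint (EuclideanSpace ℝ (Fin n))) {ψ : EuclideanSpace ℝ (Fin n) → ℝ}
    (hψm : Measurable ψ) (hψ0 : ∀ u, 0 ≤ ψ u) {D : ℝ} (hψD : ∀ u, ψ u ≤ D) {δ m : ℝ} (hδ : 0 < δ)
    {x₀ : EuclideanSpace ℝ (Fin n)}
    (hlow : (∃ i, z i = x₀ ∧ δ ≤ mixtureWeight n K σ) ∨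
      ∀ u, δ * Real.exp (-(1 / (2 * σ ^ 2)) * ‖u - x₀‖ ^ 2) ≤ ψ u)
    (hm : ∫ u, Real.log (mixtureWeight n K σ * ∑ i, extendedKernel σ (z i) u + ψ u) ∂μ < m) :
    ∃ V ∈ 𝓝 z, ∃ H : EuclideanSpace ℝ (Fin n) → ℝ, Measurable H ∧ Integrable H μ ∧
      (∀ ξ : Fin K → EuclideanSpace ℝ (Fin n), (fun i => (ξ i : OnePoint _)) ∈ V →
        ∀ u, Real.log (mixtureDensity σ u ξ) ≤ H u) ∧ ∫ u, H u ∂μ < m := by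
  have hκ := mixtureWeight_pos (n := n) hK hσ
  choose V h hV hc h0 h1 hVh hlim using fun i => exists_kernel_envelopes σ hσ (z i)
  set F : ℕ → EuclideanSpace ℝ (Fin n) → ℝ := fun k u =>
    mixtureWeight n K σ * ∑ i, h i k u + ψ u with hFdef
  have hFm : ∀ k, Measurable (F k) := by
    intro k
    have := fun i => (hc i k).measurable
    simp only [hFdef]
    fun_prop
  have hFlow : ∀ k u, δ * Real.exp (-(1 / (2 * σ ^ 2)) * ‖u - x₀‖ ^ 2) ≤ F k u := by
    intro k u
    have hs : 0 ≤ ∑ i, h i k u := Finset.sum_nonneg fun i _ => h0 i k u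
    rcases hlow with ⟨i, hi, hδw⟩ | hlow
    -- The finite center `x₀ = z i` lies in its own neighbourhood, so every envelope `h i k`
    -- dominates the kernel at `x₀`.
    · have h2 : Real.exp (-(1 / (2 * σ ^ 2)) * ‖u - x₀‖ ^ 2) ≤ h i k u :=
        hVh i k x₀ u (hi ▸ mem_of_mem_nhds (hV i k))
      have h3 : h i k u ≤ ∑ i, h i k u :=
        Finset.single_le_sum (f := fun i => h i k u) (fun i _ => h0 i k u) (Finset.mem_univ i)
      have h4 : δ * Real.exp (-(1 / (2 * σ ^ 2)) * ‖u - x₀‖ ^ 2) ≤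
          mixtureWeight n K σ * ∑ i, h i k u :=
        mul_le_mul hδw (h2.trans h3) (Real.exp_pos _).le hκ.le
      have := hψ0 u
      simp only [hFdef]
      linarith
    · have := hlow u
      have : 0 ≤ mixtureWeight n K σ * ∑ i, h i k u := by positivity
      simp only [hFdef]
      linarith [hlow u]
  have hFup : ∀ k u, F k u ≤ mixtureWeight n K σ * K + D := by
    intro k u
    have : ∑ i, h i k u ≤ (K : ℝ) := by
      calc ∑ i, h i k u ≤ ∑ _i : Fin K, (1 : ℝ) := Finset.sum_le_sum fun i _ => h1 i k u
        _ = K := by simp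
    simp only [hFdef]
    gcongr
    exact hψD u
  have hβ : 0 ≤ 1 / (2 * σ ^ 2) := by positivity
  have hFlim := tendsto_integral_log_of_gaussian_bounds (hμ x₀)
    (F' := fun u => mixtureWeight n K σ * ∑ i, extendedKernel σ (z i) u + ψ u)
    hFm hδ hβ hFlow hFup
    fun u => ((tendsto_finsetSum _ fun i _ => hlim i u).const_mul _).add_const _
  -- The means of the log-envelopes converge to a limit below `m`, so one large index already gives
  -- the neighbourhood and the envelope.
  obtain ⟨k, hk⟩ := (hFlim.eventually_lt_const hm).exists
  refine ⟨Set.univ.pi fun i => V i k, set_pi_mem_nhds Set.finite_univ fun i _ => hV i k,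
    fun u => Real.log (F k u), (hFm k).log,
    integrable_log_of_gaussian_bounds (hμ x₀) (hFm k) hδ hβ
      (Eventually.of_forall fun u => ⟨hFlow k u, hFup k u⟩), fun ξ hξ u => ?_, hk⟩
  refine Real.log_le_log (mixtureDensity_pos hK hσ u ξ) ?_
  rw [mixtureDensity_eq]
  have h5 : ∑ i, Real.exp (-(1 / (2 * σ ^ 2)) * ‖u - ξ i‖ ^ 2) ≤ ∑ i, h i k u :=
    Finset.sum_le_sum fun i _ => hVh i k (ξ i) u (hξ i (Set.mem_univ i))
  have := hψ0 u
  have : mixtureWeight n K σ * ∑ i, Real.exp (-(1 / (2 * σ ^ 2)) * ‖u - ξ i‖ ^ 2) ≤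
    mixtureWeight n K σ * ∑ i, h i k u := by gcongr
  simp only [hFdef]
  linarith

/-- With all centers finite, the first one supplies the Gaussian minorant, so `ψ = 0` suffices. -/
theorem exists_mixture_envelope_coe (hK : 0 < K) (hσ : 0 < σ)
    {μ : Measure (EuclideanSpace ℝ (Fin n))} [IsFiniteMeasure μ]
    (hμ : ∀ x₀, Integrable (fun x => ‖x - x₀‖ ^ 2) μ) (η : Fin K → EuclideanSpace ℝ (Fin n))
    {m : ℝ} (hm : ∫ u, Real.log (mixtureDensity σ u η) ∂μ < m) :
    ∃ V ∈ 𝓝 fun i => (η i : OnePoint (EuclideanSpace ℝ (Fin n))),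
      ∃ H : EuclideanSpace ℝ (Fin n) → ℝ, Measurable H ∧ Integrable H μ ∧
      (∀ ξ : Fin K → EuclideanSpace ℝ (Fin n), (fun i => (ξ i : OnePoint _)) ∈ V →
        ∀ u, Real.log (mixtureDensity σ u ξ) ≤ H u) ∧ ∫ u, H u ∂μ < m := by
  refine exists_mixture_envelope hK hσ hμ _ (ψ := fun _ => 0) measurable_const (fun _ => le_rfl)
    (fun _ => le_rfl) (mixtureWeight_pos (n := n) hK hσ) (Or.inl ⟨⟨0, hK⟩, rfl, le_rfl⟩) ?_
  simpa [mixtureDensity_eq, extendedKernel] using hm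

/-- A vector of centers some of which are at infinity has an envelope with mean below that of a
suitable vector of finite centers. -/
theorem exists_mixture_envelope_infty (hK : 0 < K) (hσ : 0 < σ)
    {μ : Measure (EuclideanSpace ℝ (Fin n))} [IsProbabilityMeasure μ]
    (hμ : ∀ x₀, Integrable (fun x => ‖x - x₀‖ ^ 2) μ)
    {z : Fin K → OnePoint (EuclideanSpace ℝ (Fin n))} {j : Fin K} (hj : z j = OnePoint.infty)
    {m : ℝ}
    (hm : ∀ ξ : Fin K → EuclideanSpace ℝ (Fin n), ∫ u, Real.log (mixtureDensity σ u ξ) ∂μ ≤ m) :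
    ∃ V ∈ 𝓝 z, ∃ H : EuclideanSpace ℝ (Fin n) → ℝ, Measurable H ∧ Integrable H μ ∧
      (∀ ξ : Fin K → EuclideanSpace ℝ (Fin n), (fun i => (ξ i : OnePoint _)) ∈ V →
        ∀ u, Real.log (mixtureDensity σ u ξ) ≤ H u) ∧ ∫ u, H u ∂μ < m := by
  have hκ := mixtureWeight_pos (n := n) hK hσ
  set κ := mixtureWeight n K σ with hκdef
  set φ : EuclideanSpace ℝ (Fin n) → ℝ := fun u =>
    Real.exp (-(1 / (2 * σ ^ 2)) * ‖u - 0‖ ^ 2) with hφ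
  have hφ0 : ∀ u, 0 < φ u := fun u => Real.exp_pos _
  -- The competitor `η` moves the infinite centers to the origin. Each of them, in particular center
  -- `j`, gains the kernel `φ`.
  set η : Fin K → EuclideanSpace ℝ (Fin n) := fun i => (z i).elim 0 id with hη
  have hker : ∀ i u, extendedKernel σ (z i) u ≤
      Real.exp (-(1 / (2 * σ ^ 2)) * ‖u - η i‖ ^ 2) := by
    intro i u
    simp only [hη]
    induction z i with
    | infty => simpa [extendedKernel] using (Real.exp_pos _).le
    | coe x => simp [extendedKernel]
  have hsum : ∀ u, ∑ i, extendedKernel σ (z i) u + φ u ≤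
      ∑ i, Real.exp (-(1 / (2 * σ ^ 2)) * ‖u - η i‖ ^ 2) := by
    intro u
    rw [← Finset.add_sum_erase _ _ (Finset.mem_univ j), ← Finset.add_sum_erase
      (a := j) (f := fun i => Real.exp (-(1 / (2 * σ ^ 2)) * ‖u - η i‖ ^ 2)) _ (Finset.mem_univ j)]
    have h1 : extendedKernel σ (z j) u = 0 := by simp [hj, extendedKernel]
    have h2 : Real.exp (-(1 / (2 * σ ^ 2)) * ‖u - η j‖ ^ 2) = φ u := by simp [hη, hj, hφ]
    have h3 := Finset.sum_le_sum fun i (_ : i ∈ Finset.univ.erase j) => hker i u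
    rw [h1, h2]
    linarith
  -- Adding only half of the weight of `φ` serves two ends: `G` dominates a Gaussian even if all
  -- centers are infinite, yet stays strictly below the mixture at `η`.
  set G : EuclideanSpace ℝ (Fin n) → ℝ := fun u =>
    κ * ∑ i, extendedKernel σ (z i) u + κ / 2 * φ u with hG
  have hGlow : ∀ u, κ / 2 * φ u ≤ G u := fun u => by
    have : 0 ≤ κ * ∑ i, extendedKernel σ (z i) u :=
      mul_nonneg hκ.le (Finset.sum_nonneg fun i _ => extendedKernel_nonneg σ (z i) u)
    simp only [hG]
    linarith
  have hGlt : ∀ u, G u < mixtureDensity σ u η := fun u => by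
    rw [mixtureDensity_eq]
    have h1 := mul_le_mul_of_nonneg_left (hsum u) hκ.le
    have h2 : 0 < κ / 2 * φ u := mul_pos (half_pos hκ) (hφ0 u)
    simp only [hG]
    linarith
  have hGm : Measurable G := by
    have : ∀ i, Measurable (extendedKernel σ (z i)) := by
      intro i
      induction z i with
      | infty =>
        exact (measurable_const : Measurable fun _ : EuclideanSpace ℝ (Fin n) => (0 : ℝ))
      | coe x =>
        have : Continuous fun u : EuclideanSpace ℝ (Fin n) =>
          Real.exp (-(1 / (2 * σ ^ 2)) * ‖u - x‖ ^ 2) := by fun_prop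
        exact this.measurable
    simp only [hG, hφ]
    fun_prop
  have hβ : 0 ≤ 1 / (2 * σ ^ 2) := by positivity
  have hGi : Integrable (fun u => Real.log (G u)) μ :=
    integrable_log_of_gaussian_bounds (hμ 0) hGm (half_pos hκ) hβ
      (C := κ * K) (Eventually.of_forall fun u =>
        ⟨hGlow u, (hGlt u).le.trans (mixtureDensity_le hK hσ u η)⟩)
  have hfi := integrable_log_mixtureDensity hK hσ hμ η
  have hlog : ∀ u, Real.log (G u) < Real.log (mixtureDensity σ u η) := fun u =>
    Real.log_lt_log (lt_of_lt_of_le (mul_pos (half_pos hκ) (hφ0 u)) (hGlow u)) (hGlt u)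
  have hlt : ∫ u, Real.log (G u) ∂μ < ∫ u, Real.log (mixtureDensity σ u η) ∂μ := by
    rw [← sub_pos, ← integral_sub hfi hGi, integral_pos_iff_support_of_nonneg
      (fun u => (sub_pos.2 (hlog u)).le) (hfi.sub hGi)]
    have : (Function.support fun u => Real.log (mixtureDensity σ u η) - Real.log (G u)) =
        Set.univ := Set.eq_univ_of_forall fun u => (sub_pos.2 (hlog u)).ne'
    rw [this]
    simp
  refine exists_mixture_envelope hK hσ hμ z (ψ := fun u => κ / 2 * φ u) (D := κ / 2) ?_
    (fun u => (mul_pos (half_pos hκ) (hφ0 u)).le) (fun u => ?_) (half_pos hκ)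
    (Or.inr fun u => le_rfl) (hlt.trans_le (hm η))
  · simp only [hφ]
    fun_prop
  · exact mul_le_of_le_one_right (half_pos hκ).le (exp_neg_mul_sq_le_one σ _)

end Envelope

/-! ### Strong consistency of the maximizers -/

section Consistency

variable {n M K : ℕ} {σ : ℝ}

/-- Splitting the logarithm of the quotient can fail where `g` vanishes, but that set is null for
the data. The first integral does not involve `ξ`, so minimizing the criterion means maximizing the
mean log-density. -/
theorem integrable_log_div_mixtureDensity (hK : 0 < K) (hσ : 0 < σ)
    {g : EuclideanSpace ℝ (Fin n) → ℝ} (hg : Measurable g)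
    [IsFiniteMeasure (measureOfDensity g)]
    (hμ : ∀ x₀, Integrable (fun x => ‖x - x₀‖ ^ 2) (measureOfDensity g))
    (hlog : Integrable (fun x => Real.log (g x)) (measureOfDensity g))
    (ξ : Fin K → EuclideanSpace ℝ (Fin n)) :
    Integrable (fun u => Real.log (g u / mixtureDensity σ u ξ)) (measureOfDensity g) ∧
      klic g σ ξ = ∫ u, Real.log (g u) ∂(measureOfDensity g) -
        ∫ u, Real.log (mixtureDensity σ u ξ) ∂(measureOfDensity g) := by
  have hf := integrable_log_mixtureDensity hK hσ hμ ξ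
  have he : (fun u => Real.log (g u) - Real.log (mixtureDensity σ u ξ))
      =ᵐ[measureOfDensity g] fun u => Real.log (g u / mixtureDensity σ u ξ) := by
    filter_upwards [ae_pos_measureOfDensity hg] with u hu
    rw [Real.log_div hu.ne' (mixtureDensity_pos hK hσ u ξ).ne']
  exact ⟨(hlog.sub hf).congr he, by rw [klic, ← integral_congr_ae he, integral_sub hlog hf]⟩

/-- Maximizers of the average log-density of a Gaussian mixture are strongly consistent for the
unique maximizer of the mean log-density. -/
theorem ae_tendsto_of_isQMLE (hK : 0 < K) (hσ : 0 < σ)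
    {μ : Measure (EuclideanSpace ℝ (Fin n))} [IsProbabilityMeasure μ]
    (hμ : ∀ x₀, Integrable (fun x => ‖x - x₀‖ ^ 2) μ)
    {Θ : Set (Fin K → EuclideanSpace ℝ (Fin n))} (hΘ : Θ = Set.univ ∨ IsCompact Θ)
    {ξs : Fin K → EuclideanSpace ℝ (Fin n)} (hξs : ξs ∈ Θ)
    (hmax : ∀ ξ ∈ Θ, ξ ≠ ξs →
      ∫ u, Real.log (mixtureDensity σ u ξ) ∂μ < ∫ u, Real.log (mixtureDensity σ u ξs) ∂μ)
    {Ω : Type*} [MeasurableSpace Ω] {P : Measure Ω}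
    {X : ℕ → Ω → EuclideanSpace ℝ (Fin n)} (hindep : iIndepFun X P)
    (hlaw : ∀ i, HasLaw (X i) μ P) {ξhat : ℕ → Ω → Fin K → EuclideanSpace ℝ (Fin n)}
    (hξhat : ∀ᵐ ω ∂P, ∀ L : ℕ, 0 < L → IsQMLE σ Θ (fun i => X i ω) L (ξhat L ω)) :
    ∀ᵐ ω ∂P, Tendsto (fun L => ξhat L ω) atTop (𝓝 ξs) := by
  set ι : (Fin K → EuclideanSpace ℝ (Fin n)) → Fin K → OnePoint (EuclideanSpace ℝ (Fin n)) :=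
    Pi.map fun _ => OnePoint.some with hι
  have hιi : Topology.IsInducing ι :=
    Topology.IsInducing.piMap fun _ => OnePoint.isOpenEmbedding_coe.isInducing
  set m := ∫ u, Real.log (mixtureDensity σ u ξs) ∂μ
  have hcomp : ∃ C : Set (Fin K → OnePoint (EuclideanSpace ℝ (Fin n))), IsCompact C ∧
      (∀ ξ ∈ Θ, ι ξ ∈ C) ∧ ∀ z ∈ C, z ≠ ι ξs → ∃ V ∈ 𝓝 z,
        ∃ H : EuclideanSpace ℝ (Fin n) → ℝ, Measurable H ∧ Integrable H μ ∧
        (∀ ξ : Fin K → EuclideanSpace ℝ (Fin n), ι ξ ∈ V →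
          ∀ u, Real.log (mixtureDensity σ u ξ) ≤ H u) ∧ ∫ u, H u ∂μ < m := by
    rcases hΘ with rfl | hΘ
    -- The product of the compactified spaces is itself compact. The competitor with finite centers
    -- used at infinity is admissible since `Θ` is the whole space.
    · refine ⟨Set.univ, isCompact_univ, fun _ _ => Set.mem_univ _, fun z _ hz => ?_⟩
      by_cases h : ∃ j, z j = OnePoint.infty
      · obtain ⟨j, hj⟩ := h
        refine exists_mixture_envelope_infty hK hσ hμ hj fun ξ => ?_
        rcases eq_or_ne ξ ξs with rfl | hne
        · exact le_rfl
        · exact (hmax ξ (Set.mem_univ _) hne).le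
      · push Not at h
        choose η hη using fun j => OnePoint.ne_infty_iff_exists.1 (h j)
        obtain rfl : ι η = z := funext hη
        exact exists_mixture_envelope_coe hK hσ hμ η
          (hmax η (Set.mem_univ _) fun he => hz (congrArg ι he))
    · refine ⟨ι '' Θ, hΘ.image hιi.continuous, fun ξ hξ => Set.mem_image_of_mem ι hξ, ?_⟩
      rintro _ ⟨η, hη, rfl⟩ hz
      exact exists_mixture_envelope_coe hK hσ hμ η (hmax η hη fun he => hz (congrArg ι he))
  obtain ⟨C, hC, hΘC, henv⟩ := hcomp
  obtain ⟨U, hU⟩ := (𝓝 ξs).exists_antitone_basis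
  have key : ∀ k, ∀ᵐ ω ∂P, ∀ᶠ L : ℕ in atTop, ξhat L ω ∈ U k := by
    intro k
    -- As `ι` induces the topology, `U k` contains the preimage of an open neighbourhood `W'` of `ι
    -- ξs`. The set `C \ W'` is compact and avoids `ι ξs`, so Wald's argument eventually excludes
    -- the estimator from it.
    obtain ⟨W, hW, hWU⟩ := (hιi.nhds_eq_comap ξs ▸ hU.mem k : U k ∈ comap ι (𝓝 (ι ξs)))
    obtain ⟨W', hW'W, hW'o, hW'⟩ := mem_nhds_iff.1 hW
    have h := ae_eventually_sum_lt_of_compact hindep hlaw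
      (q := fun u ξ => Real.log (mixtureDensity σ u ξ)) (t₀ := ξs)
      (continuous_mixtureDensity σ ξs).measurable.log
      (integrable_log_mixtureDensity hK hσ hμ ξs) Θ ι (hC.diff hW'o) fun z hz => by
        obtain ⟨V, hV, H, h1, h2, h3, h4⟩ := henv z hz.1 fun he => hz.2 (he ▸ hW')
        exact ⟨V, hV, H, h1, h2, fun ξ _ => h3 ξ, h4⟩
    filter_upwards [h, hξhat] with ω hω hq
    filter_upwards [hω, eventually_gt_atTop 0] with L hL hL0
    obtain ⟨hmem, hmaxL⟩ := hq L hL0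
    by_contra hnot
    have hlt := hL (ξhat L ω) hmem ⟨hΘC _ hmem, fun hW'' => hnot (hWU (hW'W hW''))⟩
    have hle : quasiLogLikelihood σ (fun i => X i ω) L ξs ≤
      quasiLogLikelihood σ (fun i => X i ω) L (ξhat L ω) := hmaxL hξs
    have hL' : (0 : ℝ) < L := Nat.cast_pos.2 hL0
    unfold quasiLogLikelihood at hle
    exact absurd (le_of_mul_le_mul_left hle (by positivity)) (not_le.2 hlt)
  filter_upwards [ae_all_iff.2 key] with ω hω
  exact hU.tendsto_right_iff.2 fun k _ => hω k

end Consistency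

/-! ### The main theorem -/

theorem theorem3 {n M K : ℕ} (hn : 0 < n) (hM : 0 < M) (hK : 0 < K)
    -- the data model: weight of the uniform part, noise covariance, sources, bounding box
    (w : ℝ) (hw0 : 0 < w) (hw1 : w ≤ 1)
    (S : Matrix (Fin n) (Fin n) ℝ) (hS : S.PosDef)
    (y : Fin M → EuclideanSpace ℝ (Fin n))
    (a b : EuclideanSpace ℝ (Fin n)) (hab : ∀ i, a i < b i)
    -- the approximating family and its parameter set
    (σ : ℝ) (hσ : 0 < σ)
    (Θ : Set (Fin K → EuclideanSpace ℝ (Fin n))) (hΘ : Θ = Set.univ ∨ IsCompact Θ)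
    -- the expectation of the data density exists, and the KLIC has a unique minimizer
    (hE : Integrable (dataDensity w S y a b) (measureOfDensity (dataDensity w S y a b)))
    (ξs : Fin K → EuclideanSpace ℝ (Fin n))
    (hξs : IsUniqueMinimizerOn (klic (dataDensity w S y a b) σ) Θ ξs)
    -- i.i.d. observations from the data model
    {Ω : Type*} [MeasurableSpace Ω] (P : Measure Ω) [IsProbabilityMeasure P]
    (X : ℕ → Ω → EuclideanSpace ℝ (Fin n)) (hindep : iIndepFun X P)
    (hlaw : ∀ i, HasLaw (X i) (measureOfDensity (dataDensity w S y a b)) P)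
    -- the quasi-maximum-likelihood estimators
    (ξhat : ℕ → Ω → Fin K → EuclideanSpace ℝ (Fin n))
    (hξhat : ∀ᵐ ω ∂P, ∀ L : ℕ, 0 < L → IsQMLE σ Θ (fun i => X i ω) L (ξhat L ω)) :
    (∀ᵐ ω ∂P, Tendsto (fun L => ξhat L ω) atTop (𝓝 ξs)) ∧
    (∀ ξ : Fin K → EuclideanSpace ℝ (Fin n),
      Integrable (fun u => Real.log (dataDensity w S y a b u / mixtureDensity σ u ξ))
        (measureOfDensity (dataDensity w S y a b))) ∧
    0 < klic (dataDensity w S y a b) σ ξs ∧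
    (∀ ξ : Fin K → EuclideanSpace ℝ (Fin n),
      measureOfDensity (fun u => mixtureDensity σ u ξ) ≠
        measureOfDensity (dataDensity w S y a b)) := by
  set g := dataDensity w S y a b with hgdef
  have hg : Measurable g := measurable_dataDensity w S y a b
  have hg0 : ∀ x, 0 ≤ g x := dataDensity_nonneg hw0 hw1 S y hab
  -- The total mass one is inherited from the law of an observation, with no need to integrate the
  -- density.
  have hprob : IsProbabilityMeasure (measureOfDensity g) := by
    rw [← (hlaw 0).map_eq]
    exact Measure.isProbabilityMeasure_map (hlaw 0).aemeasurable
  have hμ : ∀ x₀, Integrable (fun x => ‖x - x₀‖ ^ 2) (measureOfDensity g) := fun x₀ =>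
    (integrable_measureOfDensity_iff hg hg0).2
      (integrable_dataDensity_mul_sq_norm w hS y a b x₀)
  have hlog := integrable_log_dataDensity hM hw0 hw1 hS y hab hμ
  have hkl := fun ξ => integrable_log_div_mixtureDensity hK hσ hg hμ hlog ξ
  have hne := fun ξ => measureOfDensity_mixtureDensity_ne hn hK hw0 hw1 S y hab hσ ξ
  obtain ⟨hξsΘ, hmin, huniq⟩ := hξs
  refine ⟨ae_tendsto_of_isQMLE hK hσ hμ hΘ hξsΘ (fun ξ hξ hξne => ?_) hindep hlaw hξhat,
    fun ξ => (hkl ξ).1, ?_, hne⟩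
  -- A parameter whose mean log-density is at least that of `ξs` would also minimize the criterion
  -- over `Θ`, against uniqueness.
  · by_contra! hle
    refine hξne (huniq ξ hξ fun ξ' hξ' => ?_)
    have h1 : klic g σ ξs ≤ klic g σ ξ' := hmin hξ'
    have h2 : klic g σ ξ ≤ klic g σ ξs := by
      rw [(hkl ξ).2, (hkl ξs).2]
      linarith
    exact h2.trans h1
  · have := isProbabilityMeasure_mixture hK hσ ξs
    exact integral_log_div_pos_of_measureOfDensity_ne (continuous_mixtureDensity σ ξs).measurable
      hg (fun u => mixtureDensity_pos hK hσ u ξs) hg0 (hkl ξs).1 (hne ξs)
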